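/- Let $K$ be an algebraic function field in one variable over a finite field $\mathbb{F}_q$, i.e. a finite extension of a rational function field $\mathbb{F}_q(x)$. For a place $Q$ of $K/\mathbb{F}_q$ let $v_Q$ denote its normalized discrete valuation; $Q$ is rational if its residue field has degree $1$ over $\mathbb{F}_q$. For a divisor $G=\sum_P n_P P$ (a finite sum over places, $n_P\in\mathbb{Z}$) put $$L(G)=\{f\in K\setminus\{0\} \mid v_P(f)+n_P\ge 0 \text{ for all places } P\}\cup\{0\},$$ and for a rational place $Q$ define the set of $G$-non-gaps at $Q$ by $$H(Q;G)=\Big\{-v_Q(f) \;\Big|\; f\in \bigcup_{i\in\mathbb{Z}}L(G+iQ),\ f\neq 0\Big\}\subseteq\mathbb{Z}.$$ Let $Q_1\ne Q_2$ be two distinct rational places of $K$. Let $H(Q_1,Q_2)$ be the set of pairs $(n_1,n_2)\in\mathbb{Z}^2$ for which there is a nonzero $f\in K$ with no poles outside $\{Q_1,Q_2\}$ such that $v_{Q_1}(f)=-n_1$ and $v_{Q_2}(f)=-n_2$, and for $i\in\mathbb{Z}$ put $$\tau_{Q_1,Q_2}(i)=\min\{j\in\mathbb{Z}\mid (i,j)\in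 H(Q_1,Q_2)\}.$$ Then this minimum exists for every $i\in\mathbb{Z}$, the map $\tau_{Q_1,Q_2}:\mathbb{Z}\to\mathbb{Z}$ is a bijection, and for all $a_1,a_2\in\mathbb{Z}$ and $G=a_1Q_1+a_2Q_2$, the set of $G$-non-gaps at $Q_1$ is $$H(Q_1;G)=\{a\in\mathbb{Z}\mid \tau_{Q_1,Q_2}(a)\le a_2\},$$ and the set of $G$-non-gaps at $Q_2$ is $$H(Q_2;G)=\{b\in\mathbb{Z}\mid \tau_{Q_1,Q_2}^{-1}(b)\le a_1\}.$$ -/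

import Mathlib

open scoped RatFunc

noncomputable section

namespace TwoPoint

/-- A place of the function field `K` over `F`, given by its valuation ring: a discrete valuation
ring with fraction field `K` that contains the constants `F`. -/
structure Place (F K : Type*) [Field F] [Field K] [Algebra F K] where
  /-- The valuation ring of the place. -/
  ring : ValuationSubring K
  algebraMap_mem : ∀ c : F, algebraMap F K c ∈ ring
  isDVR : IsDiscreteValuationRing ring

namespace Place

variable {F K : Type*} [Field F] [Field K] [Algebra F K]

instance instIsDVR (P : Place F K) : IsDiscreteValuationRing P.ring := P.isDVR

instance instAlgebra (P : Place F K) : Algebra F P.ring :=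
  ((algebraMap F K).codRestrict P.ring.toSubring P.algebraMap_mem).toAlgebra

/-- The degree of a place: the dimension of its residue field over the field of constants. -/
def degree (P : Place F K) : ℕ :=
  Module.finrank F (IsLocalRing.ResidueField P.ring)

/-- A rational place is a place of degree one. -/
def IsRational (P : Place F K) : Prop :=
  P.degree = 1

/-- The normalized additive valuation `v_P(f)` for `f ≠ 0`: the order of vanishing of `f` at `P`.
At `f = 0` it has the value `0`, which is never used. -/
def ord (P : Place F K) (f : K) : ℤ :=
  -WithZero.log ((IsDiscreteValuationRing.maximalIdeal P.ring).valuation K f)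

end Place

/-- Divisors: finite formal sums of places with integer coefficients. -/
abbrev Divisor (F K : Type*) [Field F] [Field K] [Algebra F K] : Type _ :=
  Place F K →₀ ℤ

variable {F K : Type*} [Field F] [Field K] [Algebra F K]

/-- The coefficients of the divisor of poles `(f)_∞` of a function `f`. -/
def poleDivisor (f : K) (P : Place F K) : ℤ :=
  if P.ord f < 0 then -P.ord f else 0

/-- The Riemann-Roch space `L(G) = {f ≠ 0 | (f) + G ≥ 0} ∪ {0}`. -/
def rrSpace (G : Divisor F K) : Set K :=
  {f : K | f ≠ 0 ∧ ∀ P : Place F K, 0 ≤ P.ord f + G P} ∪ {0}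

/-- `L(G + ∞Q)`, the union of the spaces `L(G + iQ)` over all integers `i`. -/
def rrSpaceInfty (G : Divisor F K) (Q : Place F K) : Set K :=
  ⋃ i : ℤ, rrSpace (G + Finsupp.single Q i)

/-- The set `H(Q; G)` of `G`-non-gaps at `Q`. -/
def nonGaps (Q : Place F K) (G : Divisor F K) : Set ℤ :=
  {n : ℤ | ∃ f ∈ rrSpaceInfty G Q \ {0}, n = -Q.ord f}

/-- `R(Q₁, Q₂)`, the functions whose divisor of poles is supported in `{Q₁, Q₂}`. -/
def regularOutside (Q₁ Q₂ : Place F K) : Set K :=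
  {f : K | Function.support (poleDivisor (F := F) f) ⊆ {Q₁, Q₂}}

/-- The two-point Weierstrass semigroup `H(Q₁, Q₂)`. -/
def twoPointSemigroup (Q₁ Q₂ : Place F K) : Set (ℤ × ℤ) :=
  {n : ℤ × ℤ | ∃ f ∈ regularOutside Q₁ Q₂ \ {0}, Q₁.ord f = -n.1 ∧ Q₂.ord f = -n.2}

/-- `τ_{Q₁,Q₂}(i) = min {j | (i, j) ∈ H(Q₁, Q₂)}`. That the minimum exists is asserted wherever
`tau` is used. -/
def tau (Q₁ Q₂ : Place F K) (i : ℤ) : ℤ :=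
  sInf {j : ℤ | (i, j) ∈ twoPointSemigroup Q₁ Q₂}

end TwoPoint

end

/-! The heart is an exchange argument. If two functions regular outside `Q₁, Q₂` have equal order at
the rational place `Q₁`, subtracting a constant multiple cancels the leading term there, while the
larger pole order at `Q₂` survives (`exists_lt_mem_twoPointSemigroup`). Minimality then makes `tau
Q₁ Q₂` and `tau Q₂ Q₁` mutually inverse. Membership in `H(Q₁; G)` only bounds the pole order at `Q₂`
by `a₂`, which is the condition `tau Q₁ Q₂ a ≤ a₂`; swapping the places gives `H(Q₂; G)`.

Existence of the minimum needs every integer to occur as an order at `Q₁` (`exists_regular_ord_eq`)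
and a bound on zeros at `Q₂` (`exists_ord_le`). The former rests on functions with a single pole
(`exists_pole_only`), obtained without Riemann-Roch: over a finite field there are finitely many
principal parts of bounded order, so among infinitely many functions two have a difference regular
away from one place. The finiteness facts about `K` come from `exists_relation`: long families
satisfy a relation over `F[t]` that is nontrivial modulo `t`. -/

noncomputable section

namespace TwoPoint

/-! ### Places and their order functions. -/

section

namespace Place

variable {F K : Type*} [Field F] [Field K] [Algebra F K]

/-- The multiplicative valuation attached to a place. -/
abbrev val (P : Place F K) : Valuation K (WithZero (Multiplicative ℤ)) :=
  (IsDiscreteValuationRing.maximalIdeal P.ring).valuation K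

lemma val_le_one_iff (P : Place F K) {f : K} : P.val f ≤ 1 ↔ f ∈ P.ring := by
  constructor
  · intro h
    obtain ⟨a, rfl⟩ := IsDiscreteValuationRing.exists_lift_of_le_one h
    exact a.2
  · intro h
    exact (IsDiscreteValuationRing.maximalIdeal P.ring).valuation_le_one (K := K) ⟨f, h⟩

lemma ord_zero (P : Place F K) : P.ord 0 = 0 := by simp [ord]

lemma ord_one (P : Place F K) : P.ord 1 = 0 := by simp [ord]

lemma ord_mul (P : Place F K) {f g : K} (hf : f ≠ 0) (hg : g ≠ 0) :
    P.ord (f * g) = P.ord f + P.ord g := by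
  simp only [ord, map_mul]
  rw [WithZero.log_mul ((Valuation.ne_zero_iff _).2 hf) ((Valuation.ne_zero_iff _).2 hg), neg_add]

lemma ord_inv (P : Place F K) (f : K) : P.ord f⁻¹ = -P.ord f := by
  simp [ord]

lemma ord_pow (P : Place F K) (f : K) (n : ℕ) : P.ord (f ^ n) = n * P.ord f := by
  simp [ord]

lemma ord_neg (P : Place F K) (f : K) : P.ord (-f) = P.ord f := by
  simp [ord, Valuation.map_neg]

lemma ord_le_ord_iff (P : Place F K) {f g : K} (hf : f ≠ 0) (hg : g ≠ 0) :
    P.ord f ≤ P.ord g ↔ P.val g ≤ P.val f := by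
  simp only [ord, neg_le_neg_iff]
  exact WithZero.log_le_log ((Valuation.ne_zero_iff _).2 hg) ((Valuation.ne_zero_iff _).2 hf)

lemma ord_lt_ord_iff (P : Place F K) {f g : K} (hf : f ≠ 0) (hg : g ≠ 0) :
    P.ord f < P.ord g ↔ P.val g < P.val f := by
  rw [← not_le, ← not_le, ord_le_ord_iff P hg hf]

lemma mem_ring_iff (P : Place F K) {f : K} : f ∈ P.ring ↔ 0 ≤ P.ord f := by
  by_cases hf : f = 0
  · simp [hf, ord_zero, zero_mem]
  · rw [← val_le_one_iff, ← ord_one P, ord_le_ord_iff P one_ne_zero hf, map_one]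

lemma ord_pos_iff_val_lt_one (P : Place F K) {f : K} (hf : f ≠ 0) :
    0 < P.ord f ↔ P.val f < 1 := by
  rw [← ord_one P, ord_lt_ord_iff P one_ne_zero hf, map_one]

lemma ord_neg_iff_one_lt_val (P : Place F K) {f : K} : P.ord f < 0 ↔ 1 < P.val f := by
  rw [← not_le, ← mem_ring_iff, ← val_le_one_iff, not_le]

lemma ord_nonneg_sub (P : Place F K) {f g : K} (hf : 0 ≤ P.ord f) (hg : 0 ≤ P.ord g) :
    0 ≤ P.ord (f - g) :=
  P.mem_ring_iff.1 (sub_mem (P.mem_ring_iff.2 hf) (P.mem_ring_iff.2 hg))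

lemma ord_nonneg_mul (P : Place F K) {f g : K} (hf : 0 ≤ P.ord f) (hg : 0 ≤ P.ord g) :
    0 ≤ P.ord (f * g) :=
  P.mem_ring_iff.1 (mul_mem (P.mem_ring_iff.2 hf) (P.mem_ring_iff.2 hg))

lemma min_le_ord_add (P : Place F K) {f g : K} (h : f + g ≠ 0) (hf : f ≠ 0) (hg : g ≠ 0) :
    min (P.ord f) (P.ord g) ≤ P.ord (f + g) := by
  rw [min_le_iff, ord_le_ord_iff P hf h, ord_le_ord_iff P hg h, ← le_max_iff]
  exact Valuation.map_add _ _ _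

lemma ord_add_of_lt (P : Place F K) {f g : K} (hf : f ≠ 0) (hg : g ≠ 0)
    (h : P.ord f < P.ord g) : f + g ≠ 0 ∧ P.ord (f + g) = P.ord f := by
  have hv := P.val.map_add_eq_of_lt_left ((ord_lt_ord_iff P hf hg).1 h)
  refine ⟨fun h0 => ?_, ?_⟩
  · rw [h0, map_zero] at hv
    exact hf ((Valuation.zero_iff _).1 hv.symm)
  · simp only [ord]
    rw [hv]

lemma ord_sub_of_lt (P : Place F K) {f g : K} (hf : f ≠ 0) (hg : g ≠ 0)
    (h : P.ord f < P.ord g) : f - g ≠ 0 ∧ P.ord (f - g) = P.ord f := by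
  rw [sub_eq_add_neg]
  exact P.ord_add_of_lt hf (neg_ne_zero.2 hg) (by rwa [ord_neg])

lemma ord_algebraMap (P : Place F K) (c : F) : P.ord (algebraMap F K c) = 0 := by
  by_cases hc : c = 0
  · simp [hc, ord_zero]
  · refine le_antisymm ?_ (P.mem_ring_iff.1 (P.algebraMap_mem c))
    have := P.mem_ring_iff.1 (P.algebraMap_mem c⁻¹)
    rw [map_inv₀, ord_inv] at this
    linarith

lemma exists_ord_eq_one (P : Place F K) : ∃ f : K, f ≠ 0 ∧ P.ord f = 1 := by
  obtain ⟨f, hf⟩ := (IsDiscreteValuationRing.maximalIdeal P.ring).valuation_exists_uniformizer K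
  refine ⟨f, ?_, ?_⟩
  · rintro rfl
    rw [map_zero] at hf
    exact WithZero.exp_ne_zero hf.symm
  · simp [ord, hf]

lemma mem_maximalIdeal_iff (P : Place F K) (a : P.ring) :
    a ∈ IsLocalRing.maximalIdeal P.ring ↔ P.val a < 1 :=
  ((IsDiscreteValuationRing.maximalIdeal P.ring).valuation_lt_one_iff_mem (K := K) a).symm

lemma ext_ring {P Q : Place F K} (h : P.ring = Q.ring) : P = Q := by
  cases P; cases Q; congr

/-- Distinct places have incomparable valuation rings. -/
lemma exists_mem_notMem {P Q : Place F K} (h : P ≠ Q) : ∃ f ∈ P.ring, f ∉ Q.ring := by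
  by_contra! hle
  refine h (ext_ring (le_antisymm hle fun f hf => ?_))
  by_contra hfP
  rw [mem_ring_iff, not_le] at hfP
  obtain ⟨g, hg0, hg⟩ := Q.exists_ord_eq_one
  have hf0 : f ≠ 0 := by rintro rfl; simp [ord_zero] at hfP
  -- `g⁻¹ f⁻ⁿ` lies in `P.ring` for large `n`, but not in `Q.ring`
  set n := (P.ord g).natAbs
  have hmem : g⁻¹ * (f ^ n)⁻¹ ∈ P.ring := by
    rw [mem_ring_iff, ord_mul _ (inv_ne_zero hg0) (inv_ne_zero (pow_ne_zero _ hf0)), ord_inv,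
      ord_inv, ord_pow]
    have : P.ord g ≤ n := by simp only [n]; omega
    nlinarith
  have := hle _ hmem
  rw [mem_ring_iff, ord_mul _ (inv_ne_zero hg0) (inv_ne_zero (pow_ne_zero _ hf0)), ord_inv,
      ord_inv, ord_pow, hg] at this
  have h2 := Q.mem_ring_iff.1 hf
  nlinarith

instance (P : Place F K) : IsScalarTower F P.ring K := .of_algebraMap_eq fun _ => rfl

/-- Elements algebraic over the constants have neither zeros nor poles. -/
lemma ord_eq_zero_of_isAlgebraic (P : Place F K) {f : K} (hf : IsAlgebraic F f) :
    P.ord f = 0 := by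
  have key : ∀ g : K, IsAlgebraic F g → 0 ≤ P.ord g := fun g hg => by
    have h : IsIntegral P.ring g := (isAlgebraic_iff_isIntegral.1 hg).tower_top
    obtain ⟨a, rfl⟩ := IsIntegrallyClosed.isIntegral_iff.1 h
    exact P.mem_ring_iff.1 a.2
  refine le_antisymm ?_ (key f hf)
  have := key _ hf.inv
  rw [ord_inv] at this
  linarith

end Place

end

/-! ### Polynomial relations over a transcendental function. -/

section

section FunctionField
open IntermediateField
open scoped IntermediateField.algebraAdjoinAdjoin
variable {F K : Type*} [Field F] [Field K] [Algebra F K]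

lemma trdeg_eq_one [Algebra F⟮X⟯ K] [IsScalarTower F F⟮X⟯ K] [FunctionField F K] :
    Algebra.trdeg F K = 1 := by
  have h := lift_trdeg_add_eq F F⟮X⟯ K
  have hX : Algebra.trdeg F F⟮X⟯ = 1 := by
    have : Algebra.IsAlgebraic (Polynomial F) F⟮X⟯ :=
      IsLocalization.isAlgebraic F⟮X⟯ (nonZeroDivisors (Polynomial F))
    rw [← trdeg_add_eq F (Polynomial F) (A := F⟮X⟯), Polynomial.trdeg_of_isDomain,
      trdeg_eq_zero, add_zero]
  rw [hX, trdeg_eq_zero, Cardinal.lift_zero, add_zero, Cardinal.lift_one] at h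
  exact Cardinal.lift_injective (h.symm.trans Cardinal.lift_one.symm)

/-- As the transcendence degree is 1, `t` alone is a transcendence basis, so `K` is algebraic over
`F(t)`; being essentially of finite type, it is finite. -/
lemma finiteDimensional_adjoin_of_transcendental [Algebra F⟮X⟯ K] [IsScalarTower F F⟮X⟯ K]
    [FunctionField F K] {t : K} (ht : Transcendental F t) :
    FiniteDimensional (IntermediateField.adjoin F {t}) K := by
  have hb : IsTranscendenceBasis F (fun _ : Unit => t) := by
    have hi : AlgebraicIndependent F (fun _ : Unit => t) := by
      rw [algebraicIndependent_unique_type_iff]; exact ht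
    exact hi.isTranscendenceBasis_of_lift_trdeg_le_of_finite (by simp [trdeg_eq_one])
  have halg := hb.isAlgebraic_field
  rw [Set.range_const] at halg
  have : Algebra.EssFiniteType F F⟮X⟯ :=
    have : Algebra.EssFiniteType (Polynomial F) F⟮X⟯ :=
      .of_isLocalization _ (nonZeroDivisors (Polynomial F))
    .comp F (Polynomial F) F⟮X⟯
  have : Algebra.EssFiniteType F K := .comp F F⟮X⟯ K
  have : Algebra.EssFiniteType (IntermediateField.adjoin F {t}) K := .of_comp F _ K
  exact Algebra.finite_of_essFiniteType_of_isAlgebraic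

end FunctionField

open Polynomial in
/-- In a polynomial relation with a transcendental coefficient `t`, one may divide out the common
power of `t`. -/
lemma exists_relation_coeff_zero_ne_zero {F K ι : Type*} [Field F] [Field K] [Algebra F K]
    [Fintype ι] {t : K} (ht : t ≠ 0) (z : ι → K) :
    ∀ (n : ℕ) (p : ι → F[X]) (i : ι), p i ≠ 0 → (p i).natDegree ≤ n →
      ∑ j, aeval t (p j) * z j = 0 →
      ∃ q : ι → F[X], ∑ j, aeval t (q j) * z j = 0 ∧ ∃ j, (q j).coeff 0 ≠ 0 := by
  intro n
  induction n with
  | zero =>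
    intro p i hi hn hp
    refine ⟨p, hp, i, fun h => hi ?_⟩
    rw [eq_C_of_natDegree_le_zero hn, h, C_0]
  | succ n ih =>
    intro p i hi hn hp
    by_cases h : ∃ j, (p j).coeff 0 ≠ 0
    · exact ⟨p, hp, h⟩
    push Not at h
    have hX : ∀ j, p j = X * divX (p j) := fun j => by
      conv_lhs => rw [← X_mul_divX_add (p j), h j, C_0, add_zero]
    refine ih (fun j => divX (p j)) i (fun h0 => hi ?_) ?_ ?_
    · rw [hX i, h0, mul_zero]
    · rw [natDegree_divX_eq_natDegree_tsub_one]; omega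
    · have : t * ∑ j, aeval t (divX (p j)) * z j = 0 := by
        rw [← hp, Finset.mul_sum]
        refine Finset.sum_congr rfl fun j _ => ?_
        conv_rhs => rw [hX j, map_mul, aeval_X]
        ring
      exact (mul_eq_zero.1 this).resolve_left ht

open Polynomial in
/-- Any sufficiently long finite family in a function field satisfies a polynomial relation in `t`
that does not vanish modulo `t`. -/
lemma exists_relation {F K : Type*} [Field F] [Field K] [Algebra F K] [Algebra F⟮X⟯ K]
    [IsScalarTower F F⟮X⟯ K] [FunctionField F K] {t : K} (ht : Transcendental F t) :
    ∃ N : ℕ, ∀ z : Fin N → K, ∃ q : Fin N → F[X],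
      ∑ j, aeval t (q j) * z j = 0 ∧ ∃ j, (q j).coeff 0 ≠ 0 := by
  have := finiteDimensional_adjoin_of_transcendental ht
  refine ⟨Module.finrank (IntermediateField.adjoin F {t}) K + 1, fun z => ?_⟩
  have hz : ¬ LinearIndependent (IntermediateField.adjoin F {t}) z := fun h => by
    have := h.fintype_card_le_finrank
    simp at this
  -- Clearing denominators turns dependence over `F(t)` into dependence over `F[t]`.
  open scoped IntermediateField.algebraAdjoinAdjoin in
  rw [← LinearIndependent.iff_fractionRing (Algebra.adjoin F {t}),
    Fintype.linearIndependent_iff] at hz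
  push Not at hz
  obtain ⟨g, hg, i, hi⟩ := hz
  have hpoly : ∀ j, ∃ p : F[X], aeval t p = (g j : K) := fun j => by
    have h : ∀ x ∈ Algebra.adjoin F {t}, ∃ p : F[X], aeval t p = x := fun x hx => by
      rwa [Algebra.adjoin_singleton_eq_range_aeval] at hx
    exact h _ (g j).2
  choose p hp using hpoly
  refine exists_relation_coeff_zero_ne_zero (fun h => ?_) z (p i).natDegree p i (fun h => hi ?_)
    le_rfl ?_
  · rw [h] at ht; exact ht isAlgebraic_zero
  · rw [← Subtype.coe_inj, ← hp i, h]; simp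
  · simpa [hp, Algebra.smul_def] using hg

end

/-! ### Existence and approximation of places. -/

section

section PolynomialValuation
open Polynomial
variable {F K Γ : Type*} [Field F] [Field K] [Algebra F K] [LinearOrderedCommGroupWithZero Γ]
  {v : Valuation K Γ} {t : K}

lemma valuation_algebraMap_eq_one (hF : ∀ c : F, v (algebraMap F K c) ≤ 1) {c : F} (hc : c ≠ 0) :
    v (algebraMap F K c) = 1 := by
  refine le_antisymm (hF c) ?_
  have h := hF c⁻¹
  rw [map_inv₀, map_inv₀] at h
  exact (inv_le_one₀ (zero_lt_iff.2 (by simpa using hc))).1 h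

lemma valuation_aeval_le_one (hF : ∀ c : F, v (algebraMap F K c) ≤ 1) (ht : v t ≤ 1) (p : F[X]) :
    v (aeval t p) ≤ 1 := by
  rw [aeval_eq_sum_range]
  refine v.map_sum_le fun i _ => ?_
  rw [Algebra.smul_def, map_mul, map_pow]
  exact mul_le_one' (hF _) (pow_le_one₀ zero_le ht)

lemma aeval_eq_mul_divX_add (t : K) (p : F[X]) :
    aeval t p = t * aeval t (divX p) + algebraMap F K (p.coeff 0) := by
  conv_lhs => rw [← X_mul_divX_add p]
  simp only [map_add, map_mul, aeval_X, aeval_C]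

lemma valuation_aeval_le (hF : ∀ c : F, v (algebraMap F K c) ≤ 1) (ht : v t ≤ 1) {p : F[X]}
    (hp : p.coeff 0 = 0) : v (aeval t p) ≤ v t := by
  rw [aeval_eq_mul_divX_add, hp, map_zero, add_zero, map_mul]
  exact mul_le_of_le_one_right' (valuation_aeval_le_one hF ht _)

lemma valuation_aeval_eq_one (hF : ∀ c : F, v (algebraMap F K c) ≤ 1) (ht : v t < 1) {p : F[X]}
    (hp : p.coeff 0 ≠ 0) : v (aeval t p) = 1 := by
  rw [aeval_eq_mul_divX_add, ← valuation_algebraMap_eq_one hF hp]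
  refine v.map_add_eq_of_lt_right ?_
  rw [valuation_algebraMap_eq_one hF hp, map_mul]
  exact (mul_le_of_le_one_right' (valuation_aeval_le_one hF ht.le _)).trans_lt ht

lemma transcendental_of_valuation_lt_one (hF : ∀ c : F, v (algebraMap F K c) ≤ 1) (h0 : t ≠ 0)
    (ht : v t < 1) : Transcendental F t := by
  rintro ⟨p, hp0, hp⟩
  obtain ⟨q, hq⟩ := exists_relation_coeff_zero_ne_zero (F := F) (ι := Unit) h0 (fun _ => (1 : K))
    p.natDegree (fun _ => p) () hp0 le_rfl (by simpa using hp)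
  obtain ⟨hq, j, hj⟩ := hq
  have := valuation_aeval_eq_one hF ht hj
  rw [Fintype.sum_unique, mul_one] at hq
  rw [show q j = q default from rfl, hq, map_zero] at this
  exact zero_ne_one this

end PolynomialValuation

section FunctionField
open Polynomial
variable {F K : Type*} [Field F] [Field K] [Algebra F K] [Algebra F⟮X⟯ K]
  [IsScalarTower F F⟮X⟯ K] [FunctionField F K]

/-- Valuation rings of a function field that contain the constants are Noetherian. -/
lemma isNoetherianRing_valuationSubring (W : ValuationSubring K)
    (hW : ∀ c : F, algebraMap F K c ∈ W) : IsNoetherianRing W := by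
  have hF : ∀ c : F, W.valuation (algebraMap F K c) ≤ 1 := fun c =>
    (W.valuation_le_one_iff _).2 (hW c)
  rw [isNoetherianRing_iff, isNoetherian_iff, wellFounded_iff_isEmpty_descending_chain]
  refine ⟨fun ⟨I, hI⟩ => ?_⟩
  have hmono : StrictMono I := strictMono_nat_of_lt_succ hI
  -- Elements new at each step of an ascending chain of ideals have strictly increasing valuations,
  -- all at most 1. A relation over `F[a 0]` among the later ones will contradict this.
  choose a ha ha' using fun n => SetLike.exists_of_lt (hI n)
  have hlt : ∀ i j, i < j → W.valuation (a i : K) < W.valuation (a j : K) := by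
    intro i j hij
    by_contra! hle
    have hi : a i ∈ I j := hmono.monotone (Nat.succ_le_of_lt hij) (ha i)
    refine ha' j ?_
    by_cases h0 : (a i : K) = 0
    · rw [h0, map_zero, le_zero_iff, Valuation.zero_iff] at hle
      rw [show a j = 0 from Subtype.ext hle]
      exact zero_mem _
    · have hdiv : (a j : K) / a i ∈ W := by
        rw [← W.valuation_le_one_iff, map_div₀]
        exact div_le_one_of_le₀ hle zero_le
      rw [show a j = ⟨_, hdiv⟩ * a i from Subtype.ext (by simp [h0])]
      exact Ideal.mul_mem_left _ _ hi
  have hle1 : ∀ i, W.valuation (a i : K) ≤ 1 := fun i => (W.valuation_le_one_iff _).2 (a i).2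
  have h0 : (a 0 : K) ≠ 0 := fun h => ha' 0 (by
    rw [show a 0 = 0 from Subtype.ext h]; exact zero_mem _)
  have h1 : W.valuation (a 0 : K) < 1 := (hlt 0 1 one_pos).trans_le (hle1 1)
  obtain ⟨N, hN⟩ := exists_relation (transcendental_of_valuation_lt_one hF h0 h1)
  obtain ⟨q, hq, hne⟩ := hN fun i => (a (i + 1) : K)
  classical
  -- The term of largest index with nonzero constant coefficient strictly dominates: terms with zero
  -- constant coefficient have valuation at most that of `a 0`.
  obtain ⟨j, hj, hjmax⟩ := (Finset.univ.filter fun j => (q j).coeff 0 ≠ 0).exists_max_image id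
    ⟨hne.choose, by simpa using hne.choose_spec⟩
  simp only [Finset.mem_filter, Finset.mem_univ, true_and, id] at hj hjmax
  have hvj : W.valuation (aeval (a 0 : K) (q j) * (a (j + 1) : K))
      = W.valuation (a (j + 1) : K) := by
    rw [map_mul, valuation_aeval_eq_one hF h1 hj, one_mul]
  have hsum := W.valuation.map_sum_eq_of_lt (Finset.mem_univ j)
    (f := fun i => aeval (a 0 : K) (q i) * (a (i + 1) : K)) (fun i hi => by
      rw [hvj, map_mul]
      have hij : i ≠ j := by simpa using hi
      by_cases hc : (q i).coeff 0 = 0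
      · exact (mul_le_mul' (valuation_aeval_le hF h1.le hc) (hle1 _)).trans_lt
          (by rw [mul_one]; exact hlt _ _ (Nat.succ_pos _))
      · rw [valuation_aeval_eq_one hF h1 hc, one_mul]
        refine hlt _ _ ?_
        have := lt_of_le_of_ne (hjmax i hc) hij
        simpa using this)
  rw [hq, hvj, map_zero, eq_comm, Valuation.zero_iff] at hsum
  have := hlt 0 (j + 1) (Nat.succ_pos _)
  rw [hsum, map_zero] at this
  exact not_lt_zero this

/-- A valuation ring of a function field that contains the constants and a nonzero nonunit. -/
def Place.ofValuationSubring (W : ValuationSubring K) (hW : ∀ c : F, algebraMap F K c ∈ W)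
    (hne : ¬ IsField W) : Place F K where
  ring := W
  algebraMap_mem := hW
  isDVR := by
    have := isNoetherianRing_valuationSubring W hW
    exact ((IsDiscreteValuationRing.TFAE W hne).out 0 1).2 (inferInstance : ValuationRing W)

/-- Every transcendental function has a pole. -/
lemma exists_ord_neg {f : K} (hf : Transcendental F f) : ∃ P : Place F K, P.ord f < 0 := by
  have hf0 : f ≠ 0 := by rintro rfl; exact hf isAlgebraic_zero
  have ht : Transcendental F f⁻¹ := fun h => hf (by simpa using h.inv)
  let A := (Algebra.adjoin F {f⁻¹}).toSubring
  let s : A := ⟨f⁻¹, Algebra.self_mem_adjoin_singleton F _⟩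
  -- By transcendence `f⁻¹` is a nonunit of `F[f⁻¹]`, so some valuation ring above `F[f⁻¹]` has it
  -- as a nonunit and omits `f`.
  have hI : Ideal.span {s} ≠ ⊤ := by
    rw [Ne, Ideal.span_singleton_eq_top]
    rintro hu
    obtain ⟨b, hb⟩ := hu.exists_right_inv
    have hbA : (b : K) ∈ Algebra.adjoin F {f⁻¹} := b.2
    rw [Algebra.adjoin_singleton_eq_range_aeval] at hbA
    obtain ⟨p, hp⟩ := hbA
    have hb' : f⁻¹ * b = 1 := congrArg Subtype.val hb
    have hp' : aeval f⁻¹ p = b := hp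
    refine ht ⟨X * p - 1, fun h => ?_, by simp [hp', hb']⟩
    have := congrArg (fun r => coeff r 0) h
    simp at this
  obtain ⟨W, hAW, hIW⟩ := Ideal.image_subset_nonunits_valuationSubring (Ideal.span {s}) hI
  have hW : ∀ c : F, algebraMap F K c ∈ W := fun c =>
    hAW ((Algebra.adjoin F {f⁻¹}).algebraMap_mem c)
  have hs : f⁻¹ ∈ W.nonunits := hIW ⟨s, Ideal.mem_span_singleton_self s, rfl⟩
  rw [W.mem_nonunits_iff, map_inv₀] at hs
  have hfW : f ∉ W := fun h => by
    rw [← W.valuation_le_one_iff] at h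
    exact (inv_lt_one₀ (zero_lt_iff.2 (by simpa using hf0))).1 hs |>.not_ge h
  refine ⟨Place.ofValuationSubring W hW fun hfield => ?_, ?_⟩
  · have hsW : f⁻¹ ∈ W := hAW s.2
    obtain ⟨b, hb⟩ := hfield.mul_inv_cancel (a := ⟨f⁻¹, hsW⟩)
      (fun h => inv_ne_zero hf0 (congrArg Subtype.val h))
    have hb' : f⁻¹ * b = 1 := congrArg Subtype.val hb
    have : f = b := by field_simp at hb'; exact hb'.symm
    exact hfW (this ▸ b.2)
  · rw [← not_le, ← Place.mem_ring_iff]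
    exact hfW

end FunctionField

/-- A function taking a pole at one of finitely many places and a zero at all others. -/
lemma exists_pole_zeros {F K ι : Type*} [Field F] [Field K] [Algebra F K] [Finite ι]
    {P : ι → Place F K} (hP : Function.Injective P) (i : ι) :
    ∃ f : K, (P i).ord f < 0 ∧ ∀ j ≠ i, (P j).val f < 1 := by
  -- The base 2 is arbitrary; it yields real absolute values, to which weak approximation applies.
  have hb : (1 : NNReal) < 2 := one_lt_two
  let v : ι → AbsoluteValue K ℝ := fun j =>
    (IsDiscreteValuationRing.maximalIdeal (P j).ring).adicAbv hb
  have hmono := (WithZeroMulInt.toNNReal_strictMono hb)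
  have hle : ∀ j f, v j f ≤ 1 ↔ f ∈ (P j).ring := fun j f => by
    rw [← Place.val_le_one_iff, ← hmono.le_iff_le, map_one]
    rfl
  have hlt : ∀ j f, v j f < 1 ↔ (P j).val f < 1 := fun j f => by
    rw [← hmono.lt_iff_lt, map_one]
    rfl
  obtain ⟨f, hf, hf'⟩ := AbsoluteValue.exists_one_lt_lt_one_pi_of_not_isEquiv (v := v)
    (fun j => by
      obtain ⟨f, hf0, hf⟩ := (P j).exists_ord_eq_one
      refine ⟨f, hf0, ne_of_lt ?_⟩
      rw [hlt, ← Place.ord_pos_iff_val_lt_one _ hf0, hf]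
      exact one_pos)
    (fun j k hjk he => by
      obtain ⟨f, hf, hf'⟩ := Place.exists_mem_notMem (hP.ne hjk)
      rw [← hle] at hf hf'
      exact hf' (he.le_one_iff.1 hf)) i
  refine ⟨f, ?_, fun j hj => (hlt j f).1 (hf' j hj)⟩
  rw [← not_le, ← Place.mem_ring_iff, ← hle]
  exact not_le.2 hf

end

/-! ### Finiteness of poles, residue fields and principal parts. -/

section

lemma Place.val_algebraMap_le_one {F K : Type*} [Field F] [Field K] [Algebra F K] (P : Place F K)
    (c : F) : P.val (algebraMap F K c) ≤ 1 :=
  P.val_le_one_iff.2 (P.algebraMap_mem c)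

/-- A function that is a unit at one of finitely many places and has a zero at all others. -/
lemma exists_unit_zeros {F K ι : Type*} [Field F] [Field K] [Algebra F K] [Finite ι]
    {P : ι → Place F K} (hP : Function.Injective P) (i : ι) :
    ∃ f : K, (P i).val f = 1 ∧ ∀ j ≠ i, (P j).val f < 1 := by
  obtain ⟨f, hf, hf'⟩ := exists_pole_zeros hP i
  rw [Place.ord_neg_iff_one_lt_val] at hf
  -- The map `f ↦ f / (1 + f)` sends a pole to the value 1 and keeps zeros.
  refine ⟨f / (1 + f), ?_, fun j hj => ?_⟩
  · rw [map_div₀, (P i).val.map_add_eq_of_lt_right (by rwa [map_one])]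
    exact div_self (zero_lt_one.trans hf).ne'
  · rw [map_div₀, (P j).val.map_one_add_of_lt (hf' j hj), div_one]
    exact hf' j hj

section FunctionField
open Polynomial
variable {F K : Type*} [Field F] [Field K] [Algebra F K] [Algebra F⟮X⟯ K]
  [IsScalarTower F F⟮X⟯ K] [FunctionField F K]

lemma transcendental_of_ord_ne_zero {F K : Type*} [Field F] [Field K] [Algebra F K]
    {P : Place F K} {f : K} (h : P.ord f ≠ 0) : Transcendental F f :=
  fun hf => h (P.ord_eq_zero_of_isAlgebraic hf)

/-- A function has only finitely many poles. -/
lemma finite_poles (x : K) : {P : Place F K | P.ord x < 0}.Finite := by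
  rw [← Set.not_infinite]
  intro hinf
  obtain ⟨P₀, hP₀⟩ := hinf.nonempty
  have ht : Transcendental F x⁻¹ := transcendental_of_ord_ne_zero (P := P₀) (by
    have : P₀.ord x < 0 := hP₀
    rw [Place.ord_inv]; omega)
  obtain ⟨N, hN⟩ := exists_relation ht
  let P : Fin N → Place F K := fun i => hinf.natEmbedding _ i
  have hP : Function.Injective P := fun i j h =>
    Fin.ext ((hinf.natEmbedding _).injective (Subtype.ext h))
  have hPx : ∀ i, (P i).val x⁻¹ < 1 := fun i => by
    have h : (P i).ord x < 0 := (hinf.natEmbedding _ (i : ℕ)).2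
    rw [Place.ord_neg_iff_one_lt_val] at h
    rw [map_inv₀]
    exact inv_lt_one_of_one_lt₀ h
  -- In a relation among the `z i` over `F[x⁻¹]`, a term with nonzero constant coefficient is a unit
  -- at its own place, where all other terms vanish.
  choose z hz hz' using fun i => exists_unit_zeros hP i
  obtain ⟨q, hq, j, hj⟩ := hN z
  classical
  have hvj : (P j).val (aeval x⁻¹ (q j) * z j) = 1 := by
    rw [map_mul, hz, valuation_aeval_eq_one (P j).val_algebraMap_le_one (hPx j) hj, one_mul]
  have := (P j).val.map_sum_eq_of_lt (Finset.mem_univ j)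
    (f := fun i => aeval x⁻¹ (q i) * z i) (fun i hi => by
      have hij : j ≠ i := by simpa [eq_comm] using hi
      rw [hvj, map_mul]
      exact (mul_le_of_le_one_left'
        (valuation_aeval_le_one (P j).val_algebraMap_le_one (hPx j).le _)).trans_lt (hz' i j hij))
  rw [hq, hvj, map_zero] at this
  exact zero_ne_one this

/-- The residue field of a place is finite over the constants. -/
lemma finite_residueField (P : Place F K) : Module.Finite F (IsLocalRing.ResidueField P.ring) := by
  obtain ⟨t, ht0, ht⟩ := P.exists_ord_eq_one
  obtain ⟨N, hN⟩ := exists_relation (F := F) (t := t)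
    (transcendental_of_ord_ne_zero (P := P) (by rw [ht]; exact one_ne_zero))
  have htr : t ∈ P.ring := P.mem_ring_iff.2 (by rw [ht]; exact zero_le_one)
  let t' : P.ring := ⟨t, htr⟩
  have ht' : algebraMap P.ring (IsLocalRing.ResidueField P.ring) t' = 0 := by
    rw [IsLocalRing.ResidueField.algebraMap_eq, IsLocalRing.residue_eq_zero_iff,
      Place.mem_maximalIdeal_iff, ← Place.ord_pos_iff_val_lt_one _ ht0, ht]
    exact one_pos
  let B := Module.Basis.ofVectorSpace F (IsLocalRing.ResidueField P.ring)
  rcases finite_or_infinite (Module.Basis.ofVectorSpaceIndex F (IsLocalRing.ResidueField P.ring))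
    with hfin | hinf
  · exact Module.Finite.of_basis B
  let e : Fin N ↪ _ := Fin.valEmbedding.trans (Infinite.natEmbedding
    (Module.Basis.ofVectorSpaceIndex F (IsLocalRing.ResidueField P.ring)))
  have hli := B.linearIndependent.comp e e.injective
  -- Reducing a relation among lifts of independent residues modulo `t` leaves a nontrivial
  -- `F`-linear relation.
  choose z hz using fun i => IsLocalRing.residue_surjective (R := P.ring) (B (e i))
  obtain ⟨q, hq, j, hj⟩ := hN fun i => (z i : K)
  have hq' : ∑ i, aeval t' (q i) * z i = 0 := by
    apply Subtype.coe_injective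
    have h : ∀ p : F[X], ((aeval t' p : P.ring) : K) = aeval t p := fun p =>
      (aeval_algebraMap_apply K t' p).symm
    push_cast
    simpa [h] using hq
  have hres := congrArg (algebraMap P.ring (IsLocalRing.ResidueField P.ring)) hq'
  rw [map_sum, map_zero] at hres
  refine absurd (Fintype.linearIndependent_iff.1 hli (fun i => (q i).coeff 0) ?_ j) hj
  rw [← hres]
  refine Finset.sum_congr rfl fun i _ => ?_
  rw [map_mul, ← aeval_algebraMap_apply, ht', ← coeff_zero_eq_aeval_zero', Algebra.smul_def,
    IsLocalRing.ResidueField.algebraMap_eq P.ring, hz]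
  rfl

lemma finite_residueField' [Finite F] (P : Place F K) :
    Finite (IsLocalRing.ResidueField P.ring) :=
  have := finite_residueField P
  Module.finite_of_finite F

/-- The bound must be nonpositive because `f + g` may be zero, whose order is 0 by convention. -/
lemma Place.le_ord_add {F K : Type*} [Field F] [Field K] [Algebra F K] (P : Place F K) {n : ℤ}
    (hn : n ≤ 0) {f g : K} (hf : n ≤ P.ord f) (hg : n ≤ P.ord g) : n ≤ P.ord (f + g) := by
  by_cases h : f + g = 0
  · rwa [h, ord_zero]
  by_cases hf0 : f = 0
  · simpa [hf0] using hg
  by_cases hg0 : g = 0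
  · simpa [hg0] using hf
  exact (le_min hf hg).trans (P.min_le_ord_add h hf0 hg0)

lemma Place.le_ord_sub {F K : Type*} [Field F] [Field K] [Algebra F K] (P : Place F K) {n : ℤ}
    (hn : n ≤ 0) {f g : K} (hf : n ≤ P.ord f) (hg : n ≤ P.ord g) : n ≤ P.ord (f - g) := by
  rw [sub_eq_add_neg]
  exact P.le_ord_add hn hf (by rwa [ord_neg])

lemma Place.le_ord_sum {F K ι : Type*} [Field F] [Field K] [Algebra F K] (P : Place F K) {n : ℤ}
    (hn : n ≤ 0) (s : Finset ι) {f : ι → K} (hf : ∀ i ∈ s, n ≤ P.ord (f i)) :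
    n ≤ P.ord (∑ i ∈ s, f i) :=
  Finset.sum_induction f (fun a => n ≤ P.ord a) (fun _ _ => P.le_ord_add hn)
    (by rwa [P.ord_zero]) hf

/-- Among infinitely many functions whose differences have bounded pole order at `P`, infinitely
many have the same principal part at `P`. -/
lemma exists_infinite_subset_regular_sub [Finite F] (P : Place F K) (k : ℕ) :
    ∀ S : Set K, S.Infinite → (∀ a ∈ S, ∀ b ∈ S, -(k : ℤ) ≤ P.ord (a - b)) →
      ∃ T ⊆ S, T.Infinite ∧ ∀ a ∈ T, ∀ b ∈ T, 0 ≤ P.ord (a - b) := by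
  induction k with
  | zero => exact fun S hS h => ⟨S, subset_rfl, hS, by simpa using h⟩
  | succ k ih =>
    intro S hS h
    obtain ⟨π, hπ0, hπ⟩ := P.exists_ord_eq_one
    obtain ⟨a₀, ha₀⟩ := hS.nonempty
    have hmem : ∀ a : S, π ^ (k + 1) * ((a : K) - a₀) ∈ P.ring := fun a => by
      by_cases h0 : (a : K) - a₀ = 0
      · rw [h0, mul_zero]; exact zero_mem _
      rw [Place.mem_ring_iff, P.ord_mul (pow_ne_zero _ hπ0) h0, P.ord_pow, hπ]
      have := h a a.2 a₀ ha₀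
      push_cast at this ⊢
      linarith
    have := hS.to_subtype
    have := finite_residueField' P
    -- Pigeonhole on the coefficient of `π ^ (-(k + 1))` in `a - a₀`: where it agrees, differences
    -- have pole order at most `k`.
    obtain ⟨y, hy⟩ := Finite.exists_infinite_fiber
      fun a : S => IsLocalRing.residue P.ring ⟨_, hmem a⟩
    obtain ⟨T, hT, hT'⟩ := ih
      (Subtype.val '' ((fun a : S => IsLocalRing.residue P.ring ⟨_, hmem a⟩) ⁻¹' {y}))
      ((Set.infinite_coe_iff.1 hy).image Subtype.val_injective.injOn) (by
        rintro _ ⟨a, ha, rfl⟩ _ ⟨b, hb, rfl⟩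
        by_cases h0 : (a : K) - b = 0
        · rw [h0, P.ord_zero]; simp
        have hab := sub_eq_zero.2 (ha.trans hb.symm)
        rw [← map_sub, IsLocalRing.residue_eq_zero_iff, Place.mem_maximalIdeal_iff] at hab
        have he : ((⟨_, hmem a⟩ - ⟨_, hmem b⟩ : P.ring) : K) = π ^ (k + 1) * (a - b) := by
          push_cast; ring
        rw [he, ← Place.ord_pos_iff_val_lt_one _ (mul_ne_zero (pow_ne_zero _ hπ0) h0),
          P.ord_mul (pow_ne_zero _ hπ0) h0, P.ord_pow, hπ] at hab
        push_cast at hab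
        linarith)
    refine ⟨T, hT.trans ?_, hT'⟩
    rintro _ ⟨a, -, rfl⟩
    exact a.2

lemma exists_infinite_subset_regular_sub_finset [Finite F] (k : ℕ) {R : Set (Place F K)}
    (hR : R.Finite) {S : Set K} (hS : S.Infinite)
    (h : ∀ P ∈ R, ∀ a ∈ S, ∀ b ∈ S, -(k : ℤ) ≤ P.ord (a - b)) :
    ∃ T ⊆ S, T.Infinite ∧ ∀ P ∈ R, ∀ a ∈ T, ∀ b ∈ T, 0 ≤ P.ord (a - b) := by
  induction R, hR using Set.Finite.induction_on with
  | empty => exact ⟨S, subset_rfl, hS, by simp⟩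
  | @insert P R _ _ ih =>
    obtain ⟨T, hTS, hT, hT'⟩ := ih fun P hP => h P (Set.mem_insert_of_mem _ hP)
    obtain ⟨U, hUT, hU, hU'⟩ := exists_infinite_subset_regular_sub P k T hT
      fun a ha b hb => h P (Set.mem_insert _ _) a (hTS ha) b (hTS hb)
    refine ⟨U, hUT.trans hTS, hU, ?_⟩
    rintro P' (rfl | hP') a ha b hb
    · exact hU' a ha b hb
    · exact hT' P' hP' a (hUT ha) b (hUT hb)

end FunctionField

end

/-! ### Functions with a pole at a single place. -/

section

open Polynomial

section
variable {F K : Type*} [Field F] [Field K] [Algebra F K]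

/-- A polynomial in `x` has no poles where `x` has none. -/
lemma Place.ord_nonneg_of_mem_adjoin (P : Place F K) {x a : K} (hx : 0 ≤ P.ord x)
    (ha : a ∈ Algebra.adjoin F {x}) : 0 ≤ P.ord a := by
  rw [Algebra.adjoin_singleton_eq_range_aeval] at ha
  obtain ⟨p, rfl⟩ := ha
  rw [← mem_ring_iff, ← val_le_one_iff] at hx ⊢
  exact valuation_aeval_le_one P.val_algebraMap_le_one hx p

/-- A function integral over `F[x]` has no poles where `x` has none. -/
lemma Place.ord_nonneg_of_isIntegral (P : Place F K) {x a : K} (hx : 0 ≤ P.ord x)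
    (ha : IsIntegral (Algebra.adjoin F {x}) a) : 0 ≤ P.ord a := by
  obtain ⟨p, hp, hpa⟩ := ha
  let φ : Algebra.adjoin F {x} →+* P.ring :=
    (algebraMap (Algebra.adjoin F {x}) K).codRestrict P.ring.toSubring
      fun b => P.mem_ring_iff.2 (P.ord_nonneg_of_mem_adjoin hx b.2)
  have h : IsIntegral P.ring a := ⟨p.map φ, hp.map φ, by rw [eval₂_map]; exact hpa⟩
  obtain ⟨b, rfl⟩ := IsIntegrallyClosed.isIntegral_iff.1 h
  exact P.mem_ring_iff.1 b.2

/-- Write `p(x)` as `x ^ deg p` times the reversed polynomial at `x⁻¹`, which is a unit since its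
constant coefficient is the leading coefficient of `p`. -/
lemma Place.ord_aeval_of_ord_neg (P : Place F K) {x : K} (hx : P.ord x < 0) {p : F[X]}
    (hp : p ≠ 0) : aeval x p ≠ 0 ∧ P.ord (aeval x p) = p.natDegree * P.ord x := by
  have hx0 : x ≠ 0 := by rintro rfl; simp [ord_zero] at hx
  let : Invertible x := invertibleOfNonzero hx0
  have h := eval₂_reverse_mul_pow (algebraMap F K) x p
  rw [invOf_eq_inv] at h
  have hv : P.val x⁻¹ < 1 := by
    rw [← ord_pos_iff_val_lt_one _ (inv_ne_zero hx0), ord_inv]; omega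
  have h1 : P.val (eval₂ (algebraMap F K) x⁻¹ p.reverse) = 1 :=
    valuation_aeval_eq_one (p := p.reverse) P.val_algebraMap_le_one hv
      (by rw [coeff_zero_reverse]; exact leadingCoeff_ne_zero.2 hp)
  have h0 : eval₂ (algebraMap F K) x⁻¹ p.reverse ≠ 0 := fun h0 => by
    rw [h0, map_zero] at h1; exact zero_ne_one h1
  rw [aeval_def, ← h]
  refine ⟨mul_ne_zero h0 (pow_ne_zero _ hx0), ?_⟩
  rw [P.ord_mul h0 (pow_ne_zero _ hx0), P.ord_pow]
  simp only [ord] at h1 ⊢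
  rw [h1]
  simp

/-- An element of `F(x)` is the sum of a polynomial in `x` and an element that is regular at all
poles of `x`. -/
lemma exists_polynomial_part {x e : K} (he : e ∈ IntermediateField.adjoin F {x}) :
    ∃ p : F[X], ∀ P : Place F K, P.ord x < 0 → 0 ≤ P.ord (e - aeval x p) := by
  obtain ⟨r, s, rfl⟩ := (IntermediateField.mem_adjoin_simple_iff F e).1 he
  by_cases hs : s = 0
  · exact ⟨0, fun P _ => by simp [hs, P.ord_zero]⟩
  -- Division with remainder: `(r % s) / s` has nonpositive degree in `x`, hence no pole where `x`
  -- has one.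
  refine ⟨r / s, fun P hP => ?_⟩
  have hs0 := P.ord_aeval_of_ord_neg hP hs
  have hdiv : aeval x r / aeval x s - aeval x (r / s) = aeval x (r % s) * (aeval x s)⁻¹ := by
    have := congrArg (aeval x) (EuclideanDomain.div_add_mod r s)
    rw [map_add, map_mul] at this
    rw [← this]
    field_simp [hs0.1]
    ring
  rw [hdiv]
  by_cases hr : r % s = 0
  · simp [hr, P.ord_zero]
  have hr0 := P.ord_aeval_of_ord_neg hP hr
  rw [P.ord_mul hr0.1 (inv_ne_zero hs0.1), P.ord_inv, hr0.2, hs0.2]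
  have hdeg : (r % s).natDegree ≤ s.natDegree :=
    natDegree_le_natDegree (EuclideanDomain.mod_lt r hs).le
  have : ((r % s).natDegree : ℤ) ≤ s.natDegree := by exact_mod_cast hdeg
  nlinarith

end

variable {F K : Type*} [Field F] [Field K] [Algebra F K] [Algebra F⟮X⟯ K]
  [IsScalarTower F F⟮X⟯ K] [FunctionField F K]

open scoped IntermediateField.algebraAdjoinAdjoin in
/-- Every function is the sum of one integral over `F[x]` and one whose pole orders at the poles of
`x` are bounded by a constant. -/
lemma exists_integral_part {x : K} (hx : Transcendental F x) :
    ∃ c : ℕ, ∀ z : K, ∃ a : K, IsIntegral (Algebra.adjoin F {x}) a ∧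
      ∀ P : Place F K, P.ord x < 0 → -(c : ℤ) ≤ P.ord (z - a) := by
  have := finiteDimensional_adjoin_of_transcendental hx
  obtain ⟨s, b, hb⟩ := FiniteDimensional.exists_is_basis_integral (Algebra.adjoin F {x})
    (IntermediateField.adjoin F {x}) K
  have hfin := finite_poles (F := F) x
  obtain ⟨c, hc⟩ : ∃ c : ℕ, ∀ P ∈ {P : Place F K | P.ord x < 0}, ∀ i, -(c : ℤ) ≤ P.ord (b i) := by
    refine ⟨∑ P ∈ hfin.toFinset, ∑ i, (P.ord (b i)).natAbs, fun P hP i => ?_⟩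
    have h1 : (P.ord (b i)).natAbs ≤ ∑ i, (P.ord (b i)).natAbs :=
      Finset.single_le_sum (f := fun i => (P.ord (b i)).natAbs) (fun _ _ => Nat.zero_le _)
        (Finset.mem_univ i)
    have h2 : ∑ i, (P.ord (b i)).natAbs ≤ ∑ P ∈ hfin.toFinset, ∑ i, (P.ord (b i)).natAbs :=
      Finset.single_le_sum (f := fun P : Place F K => ∑ i, (P.ord (b i)).natAbs)
        (fun _ _ => Nat.zero_le _) (hfin.mem_toFinset.2 hP)
    omega
  refine ⟨c, fun z => ?_⟩
  -- Replacing the coordinates in an integral basis by their polynomial parts changes `z` only by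
  -- regular multiples of the basis, whose pole orders are at most `c`.
  choose p hp using fun i => exists_polynomial_part (b.repr z i).2
  refine ⟨∑ i, aeval x (p i) * b i, IsIntegral.sum _ fun i _ => ?_, fun P hP => ?_⟩
  · refine IsIntegral.mul ?_ (hb i)
    have hmem : aeval x (p i) ∈ Algebra.adjoin F {x} := by
      rw [Algebra.adjoin_singleton_eq_range_aeval]; exact ⟨p i, rfl⟩
    exact isIntegral_algebraMap (x := (⟨_, hmem⟩ : Algebra.adjoin F {x}))
  · have hz : z - ∑ i, aeval x (p i) * b i
        = ∑ i, ((b.repr z i : K) - aeval x (p i)) * b i := by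
      conv_lhs => rw [← b.sum_repr z]
      simp only [sub_mul, Finset.sum_sub_distrib]
      rfl
    rw [hz]
    refine P.le_ord_sum (by simp) _ fun i _ => ?_
    by_cases h0 : (b.repr z i : K) - aeval x (p i) = 0
    · rw [h0, zero_mul, P.ord_zero]; simp
    rw [P.ord_mul h0 (b.ne_zero i)]
    have := hc P hP i
    have := hp i P hP
    omega

/-- For every place there is a function with a pole at this place only. -/
lemma exists_pole_only [Finite F] (Q : Place F K) :
    ∃ y : K, Q.ord y < 0 ∧ ∀ P : Place F K, P ≠ Q → 0 ≤ P.ord y := by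
  obtain ⟨t, ht0, ht⟩ := Q.exists_ord_eq_one
  set x := t⁻¹
  have hx : Q.ord x < 0 := by rw [Q.ord_inv, ht]; norm_num
  obtain ⟨c, hc⟩ := exists_integral_part (F := F) (transcendental_of_ord_ne_zero hx.ne)
  have hfin := finite_poles (F := F) x
  have := hfin.to_subtype
  obtain ⟨z, hz, hz'⟩ := exists_pole_zeros (P := fun P : {P : Place F K | P.ord x < 0} => P.1)
    Subtype.val_injective ⟨Q, hx⟩
  have hz0 : z ≠ 0 := by rintro rfl; simp [Place.ord_zero] at hz
  -- The exponent exceeds `c`, so the error of pole order at most `c` leaves the order at `Q`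
  -- unchanged.
  choose a ha ha' using fun k : ℕ => hc (z ^ (k + c + 1))
  have hQa : ∀ k, a k ≠ 0 ∧ Q.ord (a k) = (k + c + 1 : ℕ) * Q.ord z := fun k => by
    have hk := ha' k Q hx
    have hord := Q.ord_pow z (k + c + 1)
    by_cases h0 : z ^ (k + c + 1) - a k = 0
    · rw [← sub_eq_zero.1 h0]
      exact ⟨pow_ne_zero _ hz0, hord⟩
    · have hlt : Q.ord (z ^ (k + c + 1)) < Q.ord (z ^ (k + c + 1) - a k) := by
        rw [hord]
        push_cast
        have : Q.ord z ≤ -1 := by have : Q.ord z < 0 := hz; omega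
        nlinarith
      have := Q.ord_sub_of_lt (pow_ne_zero _ hz0) h0 hlt
      rwa [sub_sub_cancel, hord] at this
  have hQz : Q.ord z < 0 := hz
  have hinj : Function.Injective fun k => Q.ord (a k) := fun k l hkl => by
    simp only [(hQa _).2] at hkl
    have := mul_right_cancel₀ hQz.ne hkl
    omega
  -- Away from `Q` the `a k` have poles only at poles of `x`, of order at most `c`; infinitely many
  -- share their principal parts there.
  obtain ⟨T, hTS, hT, hT'⟩ := exists_infinite_subset_regular_sub_finset c
    (hfin.subset (Set.sdiff_subset (t := {Q})))
    (Set.infinite_range_of_injective (f := a) fun k l h => hinj (congrArg Q.ord h)) (by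
      rintro P ⟨hP, hPQ⟩ _ ⟨k, rfl⟩ _ ⟨l, rfl⟩
      have hzP : ∀ n, -(c : ℤ) ≤ P.ord (z ^ n) := fun n => by
        have h1 := (hz' ⟨P, hP⟩ (fun h => hPQ (congrArg Subtype.val h))).le
        have h2 : 0 ≤ P.ord z := P.mem_ring_iff.1 (P.val_le_one_iff.1 h1)
        rw [P.ord_pow]
        have : 0 ≤ (n : ℤ) * P.ord z := by positivity
        omega
      have haP : ∀ k, -(c : ℤ) ≤ P.ord (a k) := fun k => by
        have := P.le_ord_sub (by simp) (hzP (k + c + 1)) (ha' k P hP)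
        rwa [sub_sub_cancel] at this
      exact P.le_ord_sub (by simp) (haP k) (haP l))
  obtain ⟨_, hu, _, hv, huv⟩ := hT.nontrivial
  obtain ⟨k, rfl⟩ := hTS hu
  obtain ⟨l, rfl⟩ := hTS hv
  have hlt : ∀ k l, Q.ord (a k) < Q.ord (a l) → Q.ord (a k - a l) < 0 := fun k l h => by
    rw [(Q.ord_sub_of_lt (hQa k).1 (hQa l).1 h).2, (hQa k).2]
    have : (0 : ℤ) < (k + c + 1 : ℕ) := by positivity
    nlinarith
  refine ⟨a k - a l, ?_, fun P hPQ => ?_⟩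
  · rcases lt_or_gt_of_ne (fun h => huv (congrArg a (hinj h)) : Q.ord (a k) ≠ Q.ord (a l)) with h | h
    · exact hlt k l h
    · rw [← Q.ord_neg, neg_sub]
      exact hlt l k h
  · by_cases hP : P.ord x < 0
    · exact hT' P ⟨hP, hPQ⟩ _ hu _ hv
    · push Not at hP
      exact P.ord_nonneg_sub (P.ord_nonneg_of_isIntegral hP (ha k))
        (P.ord_nonneg_of_isIntegral hP (ha l))

end

/-! ### Orders of functions regular outside two places. -/

section

section
variable {F K : Type*} [Field F] [Field K] [Algebra F K]

/-- The value of a function at a rational place where it is regular. -/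
lemma Place.IsRational.exists_val_sub_lt_one {P : Place F K} (hP : P.IsRational) {f : K}
    (hf : f ∈ P.ring) : ∃ c : F, P.val (f - algebraMap F K c) < 1 := by
  obtain ⟨c, hc⟩ := (finrank_eq_one_iff_of_nonzero' (1 : IsLocalRing.ResidueField P.ring)
    one_ne_zero).1 hP (IsLocalRing.residue P.ring ⟨f, hf⟩)
  refine ⟨c, (P.mem_maximalIdeal_iff (⟨f, hf⟩ - algebraMap F P.ring c)).1 ?_⟩
  rw [← IsLocalRing.residue_eq_zero_iff, map_sub, ← hc, Algebra.smul_def, mul_one]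
  exact sub_self _

/-- At a rational place, two functions of equal order differ by a constant factor up to higher
order. -/
lemma Place.IsRational.exists_ord_sub_mul_lt {P : Place F K} (hP : P.IsRational) {f g : K}
    (hg : g ≠ 0) (h : P.ord f = P.ord g) :
    ∃ c : F, f - algebraMap F K c * g ≠ 0 → P.ord f < P.ord (f - algebraMap F K c * g) := by
  by_cases hf : f = 0
  · exact ⟨0, fun h0 => absurd hf (by simpa using h0)⟩
  have hmem : f / g ∈ P.ring := by
    rw [mem_ring_iff, div_eq_mul_inv, P.ord_mul hf (inv_ne_zero hg), P.ord_inv, h]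
    simp
  obtain ⟨c, hc⟩ := hP.exists_val_sub_lt_one hmem
  refine ⟨c, fun h0 => ?_⟩
  have he : f - algebraMap F K c * g = (f / g - algebraMap F K c) * g := by field_simp
  rw [he] at h0 ⊢
  have h1 := left_ne_zero_of_mul h0
  rw [P.ord_mul h1 hg, h]
  have := (P.ord_pos_iff_val_lt_one h1).2 hc
  omega

lemma Place.ord_nonneg_algebraMap_mul (P : Place F K) (c : F) {f : K} (hf : 0 ≤ P.ord f) :
    0 ≤ P.ord (algebraMap F K c * f) :=
  P.ord_nonneg_mul (P.ord_algebraMap c).ge hf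

lemma mem_twoPointSemigroup_iff {Q₁ Q₂ : Place F K} {n : ℤ × ℤ} :
    n ∈ twoPointSemigroup Q₁ Q₂ ↔ ∃ f : K, f ≠ 0 ∧
      (∀ P : Place F K, P ≠ Q₁ → P ≠ Q₂ → 0 ≤ P.ord f) ∧ Q₁.ord f = -n.1 ∧ Q₂.ord f = -n.2 := by
  have hreg : ∀ f : K, f ∈ regularOutside Q₁ Q₂ ↔
      ∀ P : Place F K, P ≠ Q₁ → P ≠ Q₂ → 0 ≤ P.ord f := fun f => by
    simp only [regularOutside, Set.mem_ofPred_eq, Function.support_subset_iff, poleDivisor]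
    refine forall_congr' fun P => ?_
    by_cases h : P.ord f < 0
    · simp [h, h.ne, not_le.2 h]; tauto
    · simp [h, not_lt.1 h]
  simp only [twoPointSemigroup, Set.mem_ofPred_eq, Set.mem_sdiff, hreg, Set.mem_singleton_iff]
  exact exists_congr fun f => by tauto

lemma twoPointSemigroup_swap {Q₁ Q₂ : Place F K} {i j : ℤ} :
    (i, j) ∈ twoPointSemigroup Q₁ Q₂ ↔ (j, i) ∈ twoPointSemigroup Q₂ Q₁ := by
  simp only [mem_twoPointSemigroup_iff]
  exact exists_congr fun f =>
    ⟨fun ⟨h0, h, h1, h2⟩ => ⟨h0, fun P p q => h P q p, h2, h1⟩,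
      fun ⟨h0, h, h1, h2⟩ => ⟨h0, fun P p q => h P q p, h2, h1⟩⟩

/-- An additive submonoid of the integers that contains elements of both signs is closed under
negation. -/
lemma neg_mem_of_pos_of_neg {S : AddSubmonoid ℤ} {a b : ℤ} (ha : a ∈ S) (hb : b ∈ S)
    (ha0 : 0 < a) (hb0 : b < 0) {s : ℤ} (hs : s ∈ S) : -s ∈ S := by
  rcases le_total 0 s with h | h
  -- Here `-s = s * b + (-b - 1) * s` with nonnegative multipliers; the other case uses `-s = (-s) *
  -- a + (a - 1) * s`.
  · have := S.add_mem (S.nsmul_mem hb s.toNat) (S.nsmul_mem hs (-b - 1).toNat)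
    rw [nsmul_eq_mul, nsmul_eq_mul, Int.toNat_of_nonneg h,
      Int.toNat_of_nonneg (by omega)] at this
    convert this using 1; ring
  · have := S.add_mem (S.nsmul_mem ha (-s).toNat) (S.nsmul_mem hs (a - 1).toNat)
    rw [nsmul_eq_mul, nsmul_eq_mul, Int.toNat_of_nonneg (by omega),
      Int.toNat_of_nonneg (by omega)] at this
    convert this using 1; ring

end

variable {F K : Type*} [Field F] [Field K] [Algebra F K] [Algebra F⟮X⟯ K]
  [IsScalarTower F F⟮X⟯ K] [FunctionField F K]

/-- The orders at `Q₁` of the nonzero functions that are regular outside `Q₁` and `Q₂`. -/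
def orders (Q₁ Q₂ : Place F K) : AddSubmonoid ℤ where
  carrier := {n | ∃ f : K, f ≠ 0 ∧ (∀ P : Place F K, P ≠ Q₁ → P ≠ Q₂ → 0 ≤ P.ord f) ∧
    Q₁.ord f = n}
  zero_mem' := ⟨1, one_ne_zero, fun P _ _ => P.ord_one.ge, Q₁.ord_one⟩
  add_mem' := by
    rintro _ _ ⟨f, hf0, hf, rfl⟩ ⟨g, hg0, hg, rfl⟩
    exact ⟨f * g, mul_ne_zero hf0 hg0, fun P h1 h2 => P.ord_nonneg_mul (hf P h1 h2) (hg P h1 h2),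
      Q₁.ord_mul hf0 hg0⟩

/-- Every integer is the order at `Q₁` of a function that is regular outside `Q₁` and `Q₂`. -/
lemma exists_regular_ord_eq [Finite F] {Q₁ Q₂ : Place F K} (hQ₁ : Q₁.IsRational) (hne : Q₁ ≠ Q₂)
    (n : ℤ) : ∃ f : K, f ≠ 0 ∧ (∀ P : Place F K, P ≠ Q₁ → P ≠ Q₂ → 0 ≤ P.ord f) ∧
      Q₁.ord f = n := by
  change n ∈ orders Q₁ Q₂
  obtain ⟨y₁, hy₁, hy₁'⟩ := exists_pole_only Q₁
  obtain ⟨y₂, hy₂, hy₂'⟩ := exists_pole_only Q₂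
  have hneg : Q₁.ord y₁ ∈ orders Q₁ Q₂ :=
    ⟨y₁, by rintro rfl; simp [Place.ord_zero] at hy₁, fun P h _ => hy₁' P h, rfl⟩
  -- Subtracting from `y₂` its value at `Q₁` produces a zero there, hence a positive order; with
  -- `y₁` this makes the orders a group.
  obtain ⟨c, hc⟩ := hQ₁.exists_val_sub_lt_one (Q₁.mem_ring_iff.2 (hy₂' Q₁ hne))
  have hreg : ∀ P : Place F K, P ≠ Q₂ → 0 ≤ P.ord (y₂ - algebraMap F K c) := fun P hP =>
    P.ord_nonneg_sub (hy₂' P hP) (P.ord_algebraMap c).ge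
  have h0 : y₂ - algebraMap F K c ≠ 0 := fun h => by
    rw [sub_eq_zero.1 h, Q₂.ord_algebraMap] at hy₂
    exact hy₂.false
  have hpos : Q₁.ord (y₂ - algebraMap F K c) ∈ orders Q₁ Q₂ := ⟨_, h0, fun P _ h => hreg P h, rfl⟩
  have hsymm : ∀ s ∈ orders Q₁ Q₂, -s ∈ orders Q₁ Q₂ := fun s hs =>
    neg_mem_of_pos_of_neg hpos hneg ((Q₁.ord_pos_iff_val_lt_one h0).2 hc) hy₁ hs
  have hone : (1 : ℤ) ∈ orders Q₁ Q₂ := by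
    obtain ⟨g, hg0, hg⟩ := Q₁.exists_ord_eq_one
    have := finiteDimensional_adjoin_of_transcendental (transcendental_of_ord_ne_zero hy₂.ne)
    open scoped IntermediateField.algebraAdjoinAdjoin in
    obtain ⟨d, hd0, hd⟩ := (((IsFractionRing.isAlgebraic_iff (Algebra.adjoin F {y₂})
      (IntermediateField.adjoin F {y₂}) K).2
        (Algebra.IsAlgebraic.isAlgebraic g))).exists_integral_multiple
    rw [Algebra.smul_def] at hd
    have hd0' : (d : K) ≠ 0 := fun h => hd0 (Subtype.ext h)
    have hd1 : Q₁.ord (d : K) ∈ orders Q₁ Q₂ :=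
      ⟨d, hd0', fun P _ hP => P.ord_nonneg_of_mem_adjoin (hy₂' P hP) d.2, rfl⟩
    have hd2 : Q₁.ord (d * g) ∈ orders Q₁ Q₂ :=
      ⟨d * g, mul_ne_zero hd0' hg0, fun P _ hP => P.ord_nonneg_of_isIntegral (hy₂' P hP) hd, rfl⟩
    have := add_mem hd2 (hsymm _ hd1)
    rwa [Q₁.ord_mul hd0' hg0, hg, add_neg_cancel_comm] at this
  have hnat : ∀ m : ℕ, (m : ℤ) ∈ orders Q₁ Q₂ := fun m => by
    simpa using (orders Q₁ Q₂).nsmul_mem hone m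
  rcases le_total 0 n with h | h
  · simpa [Int.toNat_of_nonneg h] using hnat n.toNat
  · have := hsymm _ (hnat (-n).toNat)
    rwa [Int.toNat_of_nonneg (by omega), neg_neg] at this

/-- The orders at `Q₂` of functions with a pole at most at `Q₁`, of bounded order, are bounded. -/
lemma exists_ord_le {Q₁ : Place F K} (hQ₁ : Q₁.IsRational) (Q₂ : Place F K) (n : ℕ) :
    ∃ M : ℤ, ∀ f : K, f ≠ 0 → (∀ P : Place F K, P ≠ Q₁ → 0 ≤ P.ord f) → -(n : ℤ) ≤ Q₁.ord f →
      Q₂.ord f ≤ M := by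
  induction n with
  | zero =>
    refine ⟨0, fun f _ hf h1 => ?_⟩
    have halg : IsAlgebraic F f := by
      by_contra h
      obtain ⟨P, hP⟩ := exists_ord_neg (F := F) h
      refine hP.not_ge ?_
      by_cases hPQ : P = Q₁
      · subst hPQ; simpa using h1
      · exact hf P hPQ
    exact (Q₂.ord_eq_zero_of_isAlgebraic halg).le
  | succ n ih =>
    obtain ⟨M, hM⟩ := ih
    by_cases h : ∃ g : K, g ≠ 0 ∧ (∀ P : Place F K, P ≠ Q₁ → 0 ≤ P.ord g) ∧
        -((n + 1 : ℕ) : ℤ) ≤ Q₁.ord g ∧ M < Q₂.ord g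
    swap
    · push Not at h
      exact ⟨M, h⟩
    obtain ⟨g, hg0, hg, hg1, hgM⟩ := h
    have hord : ∀ f : K, f ≠ 0 → (∀ P : Place F K, P ≠ Q₁ → 0 ≤ P.ord f) →
        -((n + 1 : ℕ) : ℤ) ≤ Q₁.ord f → M < Q₂.ord f → Q₁.ord f = -((n + 1 : ℕ) : ℤ) :=
      fun f hf0 hf hf1 hfM => by
        by_contra hcon
        refine hfM.not_ge (hM f hf0 hf ?_)
        push_cast at *
        omega
    -- If `f` had larger order at `Q₂` than `g`, cancelling the pole of order `n + 1` at `Q₁` in `g`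
    -- would keep the order of `g` at `Q₂`, above the inductive bound `M`.
    refine ⟨Q₂.ord g, fun f hf0 hf hf1 => ?_⟩
    by_contra! hlt
    obtain ⟨c, hc⟩ := hQ₁.exists_ord_sub_mul_lt hf0
      ((hord g hg0 hg hg1 hgM).trans (hord f hf0 hf hf1 (hgM.trans hlt)).symm)
    have hsub : g - algebraMap F K c * f ≠ 0 ∧ Q₂.ord (g - algebraMap F K c * f) = Q₂.ord g := by
      by_cases hc0 : c = 0
      · simpa [hc0] using hg0
      · have hc0' : algebraMap F K c ≠ 0 := by simpa using hc0
        refine Q₂.ord_sub_of_lt hg0 (mul_ne_zero hc0' hf0) ?_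
        rwa [Q₂.ord_mul hc0' hf0, Q₂.ord_algebraMap, zero_add]
    have hbound := hM _ hsub.1
      (fun P hP => P.ord_nonneg_sub (hg P hP) (P.ord_nonneg_algebraMap_mul c (hf P hP))) (by
        have := hc hsub.1
        rw [hord g hg0 hg hg1 hgM] at this
        push_cast at this
        omega)
    rw [hsub.2] at hbound
    exact hbound.not_gt hgM

end

/-! ### The exchange argument and the map `tau`. -/

section

variable {F K : Type*} [Field F] [Field K] [Algebra F K]

/-- Given two functions of the same pole order at `Q₁` and different pole orders at `Q₂`, the
larger pole order at `Q₂` occurs with a smaller pole order at `Q₁`. -/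
lemma exists_lt_mem_twoPointSemigroup {Q₁ Q₂ : Place F K} (hQ₁ : Q₁.IsRational) {i j k : ℤ}
    (hj : (i, j) ∈ twoPointSemigroup Q₁ Q₂) (hk : (i, k) ∈ twoPointSemigroup Q₁ Q₂) (hjk : j < k) :
    ∃ l < i, (l, k) ∈ twoPointSemigroup Q₁ Q₂ := by
  obtain ⟨f, hf0, hf, hf1, hf2⟩ := mem_twoPointSemigroup_iff.1 hj
  obtain ⟨g, hg0, hg, hg1, hg2⟩ := mem_twoPointSemigroup_iff.1 hk
  simp only at hf1 hf2 hg1 hg2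
  obtain ⟨c, hc⟩ := hQ₁.exists_ord_sub_mul_lt (f := g) hf0 (hg1.trans hf1.symm)
  have hsub : g - algebraMap F K c * f ≠ 0 ∧ Q₂.ord (g - algebraMap F K c * f) = Q₂.ord g := by
    by_cases hc0 : c = 0
    · simpa [hc0] using hg0
    · have hc0' : algebraMap F K c ≠ 0 := by simpa using hc0
      refine Q₂.ord_sub_of_lt hg0 (mul_ne_zero hc0' hf0) ?_
      rw [Q₂.ord_mul hc0' hf0, Q₂.ord_algebraMap]
      omega
  refine ⟨-Q₁.ord (g - algebraMap F K c * f), ?_, mem_twoPointSemigroup_iff.2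
    ⟨_, hsub.1, fun P h1 h2 => P.ord_nonneg_sub (hg P h1 h2)
      (P.ord_nonneg_algebraMap_mul c (hf P h1 h2)), by simp, by rw [hsub.2, hg2]⟩⟩
  have := hc hsub.1
  omega

section tau
variable [Algebra F⟮X⟯ K] [IsScalarTower F F⟮X⟯ K] [FunctionField F K] [Finite F]
  {Q₁ Q₂ : Place F K}

lemma isLeast_tau (hQ₁ : Q₁.IsRational) (hne : Q₁ ≠ Q₂) (i : ℤ) :
    IsLeast {j : ℤ | (i, j) ∈ twoPointSemigroup Q₁ Q₂} (tau Q₁ Q₂ i) := by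
  have hbdd : BddBelow {j : ℤ | (i, j) ∈ twoPointSemigroup Q₁ Q₂} := by
    obtain ⟨M, hM⟩ := exists_ord_le (F := F) hQ₁ Q₂ i.toNat
    -- For `j < 0` the function vanishes at `Q₂`, so its only possible pole is `Q₁` and the bound
    -- `M` applies.
    refine ⟨min 0 (-M), fun j hj => ?_⟩
    obtain ⟨f, hf0, hf, hf1, hf2⟩ := mem_twoPointSemigroup_iff.1 hj
    simp only at hf1 hf2
    by_contra! hlt
    rw [lt_min_iff] at hlt
    have := hM f hf0 (fun P hP => by
      by_cases hP2 : P = Q₂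
      · subst hP2; omega
      · exact hf P hP hP2) (by omega)
    omega
  have hnonempty : {j : ℤ | (i, j) ∈ twoPointSemigroup Q₁ Q₂}.Nonempty := by
    obtain ⟨f, hf0, hf, hf1⟩ := exists_regular_ord_eq hQ₁ hne (-i)
    exact ⟨-Q₂.ord f, mem_twoPointSemigroup_iff.2 ⟨f, hf0, hf, hf1, by simp⟩⟩
  exact ⟨Int.csInf_mem hnonempty hbdd, fun j hj => csInf_le hbdd hj⟩

/-- If `i < i'` shared the value `j`, exchange at `Q₂` would pair `i'` with something below `j`,
against minimality. -/
lemma tau_injective (hQ₁ : Q₁.IsRational) (hQ₂ : Q₂.IsRational) (hne : Q₁ ≠ Q₂) :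
    Function.Injective (tau Q₁ Q₂) := by
  have key : ∀ i i', i < i' → tau Q₁ Q₂ i ≠ tau Q₁ Q₂ i' := fun i i' hlt he => by
    have h := (isLeast_tau hQ₁ hne i).1
    have h' := (isLeast_tau hQ₁ hne i').1
    rw [Set.mem_ofPred_eq, twoPointSemigroup_swap, he] at h
    rw [Set.mem_ofPred_eq, twoPointSemigroup_swap] at h'
    obtain ⟨l, hl, hmem⟩ := exists_lt_mem_twoPointSemigroup hQ₂ h h' hlt
    exact hl.not_ge ((isLeast_tau hQ₁ hne i').2 (twoPointSemigroup_swap.1 hmem))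
  intro i i' he
  by_contra h
  rcases lt_or_gt_of_ne h with h | h
  · exact key i i' h he
  · exact key i' i h he.symm

/-- The maps `τ` for the two orderings of the places are inverse to each other. -/
lemma tau_tau_swap (hQ₁ : Q₁.IsRational) (hQ₂ : Q₂.IsRational) (hne : Q₁ ≠ Q₂) (j : ℤ) :
    tau Q₁ Q₂ (tau Q₂ Q₁ j) = j := by
  have h := twoPointSemigroup_swap.1 (isLeast_tau hQ₂ hne.symm j).1
  have hτ := isLeast_tau hQ₁ hne (tau Q₂ Q₁ j)
  refine le_antisymm (hτ.2 h) ?_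
  by_contra! hlt
  -- Exchange would pair `j` with a pole order at `Q₁` below `tau Q₂ Q₁ j`.
  obtain ⟨l, hl, hmem⟩ := exists_lt_mem_twoPointSemigroup hQ₁ hτ.1 h hlt
  exact hl.not_ge ((isLeast_tau hQ₂ hne.symm j).2 (twoPointSemigroup_swap.1 hmem))

/-- A function with prescribed order at one place and bounded pole order at another, described by
`τ`. -/
lemma tau_le_iff (hQ₁ : Q₁.IsRational) (hne : Q₁ ≠ Q₂) (a b : ℤ) :
    tau Q₁ Q₂ a ≤ b ↔ ∃ f : K, f ≠ 0 ∧ (∀ P : Place F K, P ≠ Q₁ → P ≠ Q₂ → 0 ≤ P.ord f) ∧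
      0 ≤ Q₂.ord f + b ∧ a = -Q₁.ord f := by
  constructor
  · intro h
    obtain ⟨f, hf0, hf, hf1, hf2⟩ := mem_twoPointSemigroup_iff.1 (isLeast_tau hQ₁ hne a).1
    simp only at hf1 hf2
    exact ⟨f, hf0, hf, by omega, by omega⟩
  · rintro ⟨f, hf0, hf, hf2, hf1⟩
    have := (isLeast_tau hQ₁ hne a).2 (mem_twoPointSemigroup_iff.2
      ⟨f, hf0, hf, by simp [hf1], (neg_neg _).symm⟩)
    omega

end tau

/-- The union over all multiples of `Q₁` removes the condition at `Q₁`, so `a₁` plays no role. -/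
lemma mem_nonGaps_iff {Q₁ Q₂ : Place F K} (hne : Q₁ ≠ Q₂) (a₁ a₂ a : ℤ) :
    a ∈ nonGaps Q₁ (Finsupp.single Q₁ a₁ + Finsupp.single Q₂ a₂) ↔
      ∃ f : K, f ≠ 0 ∧ (∀ P : Place F K, P ≠ Q₁ → P ≠ Q₂ → 0 ≤ P.ord f) ∧
        0 ≤ Q₂.ord f + a₂ ∧ a = -Q₁.ord f := by
  constructor
  · rintro ⟨f, ⟨hf, hf0⟩, rfl⟩
    obtain ⟨i, hi⟩ := Set.mem_iUnion.1 hf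
    rcases hi with ⟨h0, hi⟩ | h
    · refine ⟨f, h0, fun P h1 h2 => ?_, ?_, rfl⟩
      · simpa [Finsupp.single_apply, h1.symm, h2.symm] using hi P
      · simpa [Finsupp.single_apply, hne] using hi Q₂
    · exact absurd h hf0
  · rintro ⟨f, h0, hf, hf2, rfl⟩
    refine ⟨f, ⟨Set.mem_iUnion.2 ⟨-Q₁.ord f - a₁, Or.inl ⟨h0, fun P => ?_⟩⟩, h0⟩, rfl⟩
    by_cases h1 : P = Q₁
    · subst h1
      simp [hne.symm]
    · by_cases h2 : P = Q₂
      · subst h2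
        simpa [Finsupp.single_apply, hne] using hf2
      · simpa [Finsupp.single_apply, Ne.symm h1, Ne.symm h2] using hf P h1 h2

end

end TwoPoint

end

theorem mainTheorem12 {F K : Type*} [Field F] [Finite F] [Field K]
    [Algebra F K] [Algebra F⟮X⟯ K] [IsScalarTower F F⟮X⟯ K] [FunctionField F K]
    (Q₁ Q₂ : TwoPoint.Place F K) (hQ₁ : Q₁.IsRational) (hQ₂ : Q₂.IsRational) (hne : Q₁ ≠ Q₂)
    (a₁ a₂ : ℤ) (G : TwoPoint.Divisor F K)
    (hG : G = Finsupp.single Q₁ a₁ + Finsupp.single Q₂ a₂) :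
    (∀ i : ℤ, IsLeast {j : ℤ | (i, j) ∈ TwoPoint.twoPointSemigroup Q₁ Q₂}
      (TwoPoint.tau Q₁ Q₂ i)) ∧
    ∃ hτ : Function.Bijective (TwoPoint.tau Q₁ Q₂),
      TwoPoint.nonGaps Q₁ G = {a : ℤ | TwoPoint.tau Q₁ Q₂ a ≤ a₂} ∧
      TwoPoint.nonGaps Q₂ G =
        {b : ℤ | (Equiv.ofBijective (TwoPoint.tau Q₁ Q₂) hτ).symm b ≤ a₁} := by
  have hb : Function.Bijective (TwoPoint.tau Q₁ Q₂) :=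
    ⟨TwoPoint.tau_injective hQ₁ hQ₂ hne, fun j => ⟨_, TwoPoint.tau_tau_swap hQ₁ hQ₂ hne j⟩⟩
  subst hG
  refine ⟨TwoPoint.isLeast_tau hQ₁ hne, hb, ?_, ?_⟩
  · ext a
    rw [TwoPoint.mem_nonGaps_iff hne, Set.mem_ofPred_eq, TwoPoint.tau_le_iff hQ₁ hne]
  · ext b
    have hsymm : (Equiv.ofBijective (TwoPoint.tau Q₁ Q₂) hb).symm b = TwoPoint.tau Q₂ Q₁ b := by
      rw [Equiv.symm_apply_eq]
      exact (TwoPoint.tau_tau_swap hQ₁ hQ₂ hne b).symm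
    rw [add_comm, TwoPoint.mem_nonGaps_iff hne.symm, Set.mem_ofPred_eq, hsymm,
      TwoPoint.tau_le_iff hQ₂ hne.symm]
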